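/- Let $\mathcal H$ be a complex Hilbert space and, for a bounded linear operator $T$ on $\mathcal H$, let $|T|=(T^*T)^{1/2}$ and $\omega(T)=\sup_{\|x\|=1}|\langle Tx,x\rangle|$. For $p\ge 1$ and bounded operators $T_1,\dots,T_n$ on $\mathcal H$ put $$\omega_p(T_1,\dots,T_n)=\sup_{\|x\|=1}\Big(\sum_{j=1}^n|\langle T_jx,x\rangle|^p\Big)^{1/p},$$ and, for a strictly increasing convex function $f:[0,\infty)\to[0,\infty)$ with $f(0)=0$, put $\omega_f(T_1,\dots,T_n)=\sup_{\|x\|=1}f^{-1}\big(\sum_{j=1}^n f(|\langle T_jx,x\rangle|)\big)$. Let $0\le\lambda\le 1$. (i) If $1\le p\le 2$ and $f(t)=t^p$, then for all bounded operators $T_1,\dots,T_n$ on $\mathcal H$ we have $\omega_f(T_1,\dots,T_n)=\omega_p(T_1,\dots,T_n)$ and $$\begin{aligned} \omega_p(T_1,\dots,T_n) &\le\Big\|\sum_{j=1}^n\Big[(1-\lambda)\Big(\tfrac{(1-\lambda)|T_j|+(1+\lambda)|T_j^*|}{2}\Big)^p+\lambda\Big(\tfrac{(2-\lambda)|T_j|+\lambda|T_j^*|}{2}\Big)^p\Big]\Big\|^{1/p}\\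 &\le\Big\|\int_0^1\sum_{j=1}^n\big(t|T_j|+(1-t)|T_j^*|\big)^p\,dt\Big\|^{1/p}\\ &\le\Big(\tfrac12\Big\|\sum_{j=1}^n\big(|T_j|^p+|T_j^*|^p\big)\Big\|\Big)^{1/p}, \end{aligned}$$ where the operator-valued integrand is norm (Bochner) integrable on $[0,1]$. (ii) For $p=2$ and $n=1$ this gives the following refinement of $\omega^2(T)\le\frac12\||T|^2+|T^*|^2\|$: for every bounded operator $T$ on $\mathcal H$, $$\begin{aligned} \omega^2(T) &\le\Big\|(1-\lambda)\Big(\tfrac{(1-\lambda)|T|+(1+\lambda)|T^*|}{2}\Big)^2+\lambda\Big(\tfrac{(2-\lambda)|T|+\lambda|T^*|}{2}\Big)^2\Big\|\\ &\le\Big\|\int_0^1\big(t|T|+(1-t)|T^*|\big)^2\,dt\Big\| \le\tfrac12\big\||T|^2+|T^*|^2\big\|. \end{aligned}$$ -/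

import Mathlib

open scoped NNReal

noncomputable section

namespace OperatorRadius

variable {H : Type*} [NormedAddCommGroup H] [InnerProductSpace ℂ H]

/-- The numerical radius `ω(T) = sup_{‖x‖ = 1} |⟨T x, x⟩|`. -/
def numericalRadius (T : H →L[ℂ] H) : ℝ :=
  ⨆ x : {x : H // ‖x‖ = 1}, ‖inner ℂ (T x) (x : H)‖

/-- The generalized Euclidean operator radius
`ω_p(T₁, …, Tₙ) = sup_{‖x‖ = 1} (∑ j, |⟨T_j x, x⟩| ^ p) ^ (1 / p)`. -/
def euclideanRadius (p : ℝ) {n : ℕ} (T : Fin n → (H →L[ℂ] H)) : ℝ :=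
  ⨆ x : {x : H // ‖x‖ = 1}, (∑ j, ‖inner ℂ (T j x) (x : H)‖ ^ p) ^ (1 / p)

/-- The `f`-operator radius
`ω_f(T₁, …, Tₙ) = sup_{‖x‖ = 1} f⁻¹ (∑ j, f |⟨T_j x, x⟩|)`, meant for strictly increasing convex
`f : [0, ∞) → [0, ∞)` with `f 0 = 0`; such an `f` is a bijection of `[0, ∞)` and `Function.invFun f`
is its inverse. -/
def fRadius (f : ℝ≥0 → ℝ≥0) {n : ℕ} (T : Fin n → (H →L[ℂ] H)) : ℝ :=
  ⨆ x : {x : H // ‖x‖ = 1}, ((Function.invFun f (∑ j, f ‖inner ℂ (T j x) (x : H)‖₊) : ℝ≥0) : ℝ)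

end OperatorRadius

end

/-! Fix a unit vector `x`. The mixed Schwarz inequality bounds `|⟨Tx,x⟩|` by the quadratic form of
`(|T| + |T*|)/2`. This mean equals `(1-λ)M + λN`, where `M` and `N` are the values of `t|T| +
(1-t)|T*|` at the midpoints of `[0,1-λ]` and `[1-λ,1]`. Scalar convexity of the `p`-th power and
Hölder-McCarthy then give the first bound (`norm_inner_rpow_le`), for every `p ≥ 1`. The other
bounds hold in the operator order: for `1 ≤ p ≤ 2` the power is operator convex
(`CFC.convexOn_rpow`), so Hermite-Hadamard applies along the segment
(`hermiteHadamard_sum_segment_rpow`), and the norm is monotone on positive operators. -/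

open Set

/-! ### Operator convexity of powers -/

namespace CFC

open Real

variable {A : Type*} [CStarAlgebra A] [PartialOrder A] [StarOrderedRing A]

/-- `rpowIntegrand₁₂ p t` is operator convex for `0 < t`. -/
lemma convexOn_cfc_rpowIntegrand₁₂ {p t : ℝ} (ht : 0 < t) :
    ConvexOn ℝ (Ici (0 : A)) (cfc (rpowIntegrand₁₂ p t)) := by
  -- The integrand is affine in `x` plus a positive multiple of the operator convex `(t + x)⁻¹`.
  have h₁ : (Ici (0 : A)).EqOn (cfc (rpowIntegrand₁₂ p t))
      (fun x : A => t ^ (p - 1) • (t⁻¹ • x + t • Ring.inverse (algebraMap ℝ A t + x) - 1)) := by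
    intro x hx
    have hx' : 0 ≤ x := hx
    have hspectrum : ∀ r ∈ spectrum ℝ x, t + r ≠ 0 := by grind
    have hg : ContinuousOn (fun z : ℝ => (t + z)⁻¹) (spectrum ℝ x) := by
      fun_prop (disch := grind -abstractProof)
    have hinv : ContinuousOn (fun z : ℝ => t * (t + z)⁻¹) (spectrum ℝ x) := hg.const_mul t
    have hlin : ContinuousOn (fun z : ℝ => t⁻¹ * z) (spectrum ℝ x) := by fun_prop
    have h : cfc (rpowIntegrand₁₂ p t) x =
        cfc (fun z => t ^ (p - 1) * (t⁻¹ * z + t * (t + z)⁻¹ - 1)) x := rfl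
    rw [h, cfc_const_mul _ (fun z => t⁻¹ * z + t * (t + z)⁻¹ - 1) x
        ((hlin.add hinv).sub continuousOn_const),
      cfc_sub (fun z => t⁻¹ * z + t * (t + z)⁻¹) (fun _ => 1) x (hlin.add hinv),
      cfc_add x (fun z => t⁻¹ * z) (fun z => t * (t + z)⁻¹) hlin hinv,
      cfc_const_mul _ (fun z => z) x, cfc_const_mul _ (fun z => (t + z)⁻¹) x hg,
      cfc_inv _ _ hspectrum, cfc_const_add _ (fun z => z) x, cfc_id' .., cfc_const_one ..]
  refine ConvexOn.congr ?_ h₁.symm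
  refine ConvexOn.smul (by positivity) (ConvexOn.sub (ConvexOn.add ?_ ?_)
    (concaveOn_const _ (convex_Ici 0)))
  · exact ConvexOn.smul (by positivity) (convexOn_id (convex_Ici 0))
  · exact ConvexOn.smul ht.le (CStarAlgebra.convexOn_ringInverse_algebraMap_add ht)

/-- The convexity defect is exactly `ab(x - y)²`. -/
lemma convexOn_mul_self : ConvexOn ℝ (Ici (0 : A)) (fun a : A => a * a) := by
  refine ⟨convex_Ici 0, fun x hx y hy a b ha hb hab => ?_⟩
  have hx' : 0 ≤ x := hx
  have hy' : 0 ≤ y := hy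
  have h : 0 ≤ (a * b) • ((x - y) * (x - y)) :=
    smul_nonneg (by positivity) ((hx'.isSelfAdjoint.sub hy'.isSelfAdjoint).mul_self_nonneg)
  rw [← sub_nonneg]
  convert h using 1
  obtain rfl : b = 1 - a := by linarith
  simp only [mul_sub, sub_mul, mul_add, add_mul, smul_mul_assoc, mul_smul_comm, smul_sub]
  module

/-- `a ↦ a ^ p` is operator convex for `p ∈ [1,2]`. -/
lemma convexOn_rpow {p : ℝ} (hp₁ : 1 ≤ p) (hp₂ : p ≤ 2) :
    ConvexOn ℝ (Ici (0 : A)) (fun a : A => a ^ p) := by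
  -- The integral representation needs `1 < p < 2`, so both endpoints are treated by hand.
  obtain rfl | hp₁ := hp₁.eq_or_lt
  · exact (convexOn_id (convex_Ici 0)).congr fun a ha => (rpow_one a ha).symm
  obtain rfl | hp₂ := hp₂.eq_or_lt
  · refine convexOn_mul_self.congr fun a (ha : 0 ≤ a) => ?_
    have := rpow_natCast a 2 ha
    simp only [Nat.cast_ofNat] at this
    simp [this, sq]
  lift p to ℝ≥0 using by linarith
  simp_rw [← nnrpow_eq_rpow (show 0 < p from by exact_mod_cast zero_lt_one.trans hp₁)]
  obtain ⟨μ, hμ⟩ := exists_measure_nnrpow_eq_integral_cfcₙ_rpowIntegrand₁₂ A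
    (p := p) ⟨by exact_mod_cast hp₁, by exact_mod_cast hp₂⟩
  refine ConvexOn.congr ?_ fun a ha => (hμ a ha).2.symm
  refine MeasureTheory.integral_convexOn_of_integrand_ae (convex_Ici _) ?_ fun a ha => (hμ a ha).1
  filter_upwards [MeasureTheory.ae_restrict_mem measurableSet_Ioi] with t (ht : 0 < t)
  refine (convexOn_cfc_rpowIntegrand₁₂ (p := p) ht).congr fun a (ha : 0 ≤ a) => ?_
  refine (cfcₙ_eq_cfc ?_ (rpowIntegrand₁₂_zero ht)).symm
  have := (continuousOn_rpowIntegrand₁₂_uncurry (p := p) hp₁ (Ici 0) le_rfl).uncurry_left t ht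
  exact this.mono (by grind)

lemma continuousOn_rpow_of_pos {p : ℝ} (hp : 0 < p) :
    ContinuousOn (fun a : A => a ^ p) (Ici 0) := by
  lift p to ℝ≥0 using hp.le
  simp_rw [← nnrpow_eq_rpow (show 0 < p from by exact_mod_cast hp)]
  exact continuousOn_nnrpow p

/-- The tangent line inequality for `t ↦ t ^ p`. -/
lemma tangent_le_rpow {p : ℝ} (hp : 1 ≤ p) {s : ℝ} (hs : 0 < s) {a : A} (ha : 0 ≤ a) :
    (s ^ p - p * s ^ p) • (1 : A) + (p * s ^ (p - 1)) • a ≤ a ^ p := by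
  rw [rpow_eq_cfc_real ha]
  have h : (s ^ p - p * s ^ p) • (1 : A) + (p * s ^ (p - 1)) • a =
      cfc (fun t : ℝ => (s ^ p - p * s ^ p) + (p * s ^ (p - 1)) * t) a := by
    rw [cfc_const_add .., cfc_const_mul .., cfc_id' .., Algebra.algebraMap_eq_smul_one]
  rw [h]
  refine cfc_mono (fun t ht => ?_) (by fun_prop)
    (continuousOn_id.rpow_const fun _ _ => .inr (by linarith))
  have ht' : 0 ≤ t := by grind
  -- Bernoulli's inequality for `(t/s)^p`, then scaled by `s^p`.
  have hb := one_add_mul_self_le_rpow_one_add (s := t / s - 1)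
    (by linarith [div_nonneg ht' hs.le]) hp
  rw [add_sub_cancel, Real.div_rpow ht' hs.le, le_div_iff₀ (by positivity)] at hb
  refine le_trans (le_of_eq ?_) hb
  rw [Real.rpow_sub_one hs.ne']
  field_simp
  ring

end CFC

/-! ### Hermite-Hadamard in ordered Banach spaces -/

section HermiteHadamard

open MeasureTheory

/-- Symmetrizing about the midpoint reduces both halves of Hermite-Hadamard to pointwise bounds on
`f x + f (a + b - x)`. -/
lemma intervalIntegral_add_reflect {E : Type*} [NormedAddCommGroup E] [NormedSpace ℝ E]
    {f : ℝ → E} {a b : ℝ}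
    (hf : IntervalIntegrable f volume a b) :
    IntervalIntegrable (fun x => f x + f (a + b - x)) volume a b ∧
    ∫ x in a..b, (f x + f (a + b - x)) = (2 : ℝ) • ∫ x in a..b, f x := by
  have h := (hf.comp_sub_left (a + b)).symm
  simp only [add_sub_cancel_right, add_sub_cancel_left] at h
  refine ⟨hf.add h, ?_⟩
  rw [intervalIntegral.integral_add hf h, intervalIntegral.integral_comp_sub_left]
  simp [two_smul]

variable {E : Type*} [NormedAddCommGroup E] [NormedSpace ℝ E] [PartialOrder E]
  [IsOrderedAddMonoid E] [IsOrderedModule ℝ E] [ClosedIciTopology E]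

lemma intervalIntegral_mono_on_of_le {f g : ℝ → E} {a b : ℝ} (hab : a ≤ b)
    (hf : IntervalIntegrable f volume a b) (hg : IntervalIntegrable g volume a b)
    (h : ∀ x ∈ Icc a b, f x ≤ g x) : ∫ x in a..b, f x ≤ ∫ x in a..b, g x := by
  rw [intervalIntegral.integral_of_le hab, intervalIntegral.integral_of_le hab]
  refine integral_mono_ae hf.1 hg.1 ?_
  filter_upwards [ae_restrict_mem measurableSet_Ioc] with x hx
  exact h x ⟨hx.1.le, hx.2⟩

/-- The left half of the Hermite-Hadamard inequality. -/
lemma ConvexOn.smul_midpoint_le_integral [CompleteSpace E] {f : ℝ → E} {a b : ℝ} (hab : a ≤ b)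
    (hf : ConvexOn ℝ (Icc a b) f) (hi : IntervalIntegrable f volume a b) :
    (b - a) • f ((a + b) / 2) ≤ ∫ x in a..b, f x := by
  obtain ⟨hi', h⟩ := intervalIntegral_add_reflect hi
  have key : ∫ x in a..b, (2 : ℝ) • f ((a + b) / 2) ≤ ∫ x in a..b, (f x + f (a + b - x)) := by
    refine intervalIntegral_mono_on_of_le hab (by simp) hi' fun x hx => ?_
    have := hf.2 hx (show a + b - x ∈ Icc a b from ⟨by linarith [hx.2], by linarith [hx.1]⟩)
      (show (0 : ℝ) ≤ 1 / 2 by norm_num) (show (0 : ℝ) ≤ 1 / 2 by norm_num) (by norm_num)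
    have h2 := smul_le_smul_of_nonneg_left this (zero_le_two (α := ℝ))
    rw [smul_add, smul_smul, smul_smul] at h2
    convert h2 using 2
    · congr 1
      simp only [smul_eq_mul]
      ring
    · norm_num
    · norm_num
  rw [h, intervalIntegral.integral_const, smul_comm] at key
  exact le_of_smul_le_smul_left key zero_lt_two

/-- The right half of the Hermite-Hadamard inequality. -/
lemma ConvexOn.integral_le_smul_add [CompleteSpace E] {f : ℝ → E} {a b : ℝ} (hab : a ≤ b)
    (hf : ConvexOn ℝ (Icc a b) f) (hi : IntervalIntegrable f volume a b) :
    ∫ x in a..b, f x ≤ ((b - a) / 2) • (f a + f b) := by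
  obtain rfl | hlt := hab.eq_or_lt
  · simp
  obtain ⟨hi', h⟩ := intervalIntegral_add_reflect hi
  have key : ∫ x in a..b, (f x + f (a + b - x)) ≤ ∫ x in a..b, (f a + f b) := by
    refine intervalIntegral_mono_on_of_le hab hi' (by simp) fun x hx => ?_
    have h0 : 0 < b - a := sub_pos.2 hlt
    have hu : 0 ≤ (b - x) / (b - a) := div_nonneg (by linarith [hx.2]) h0.le
    have hv : 0 ≤ (x - a) / (b - a) := div_nonneg (by linarith [hx.1]) h0.le
    have huv : (b - x) / (b - a) + (x - a) / (b - a) = 1 := by field_simp; ring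
    -- `x` and its reflection are combinations of the endpoints with swapped weights, so the two
    -- bounds add up to `f a + f b`.
    have h1 := hf.2 (left_mem_Icc.2 hab) (right_mem_Icc.2 hab) hu hv huv
    have h2 := hf.2 (left_mem_Icc.2 hab) (right_mem_Icc.2 hab) hv hu (by rw [add_comm, huv])
    have e1 : ((b - x) / (b - a)) • a + ((x - a) / (b - a)) • b = x := by
      simp only [smul_eq_mul]; field_simp; ring
    have e2 : ((x - a) / (b - a)) • a + ((b - x) / (b - a)) • b = a + b - x := by
      simp only [smul_eq_mul]; field_simp; ring
    rw [e1] at h1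
    rw [e2] at h2
    refine (add_le_add h1 h2).trans (le_of_eq ?_)
    rw [add_add_add_comm, ← add_smul, ← add_smul, add_comm ((x - a) / (b - a)), huv, one_smul,
      one_smul]
  rw [h, intervalIntegral.integral_const] at key
  have := smul_le_smul_of_nonneg_left key (inv_nonneg.2 (zero_le_two (α := ℝ)))
  rwa [smul_smul, smul_smul, inv_mul_cancel₀ two_ne_zero, one_smul, ← div_eq_inv_mul] at this

end HermiteHadamard

/-! ### The mixed Schwarz inequality -/

section MixedSchwarz

open ContinuousLinearMap

variable {H : Type*} [NormedAddCommGroup H] [InnerProductSpace ℂ H] [CompleteSpace H]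

lemma ContinuousLinearMap.reApplyInnerSelf_mono {H : Type*} [NormedAddCommGroup H]
    [InnerProductSpace ℂ H] {S T : H →L[ℂ] H} (h : S ≤ T) (x : H) :
    S.reApplyInnerSelf x ≤ T.reApplyInnerSelf x := by
  have := ((ContinuousLinearMap.le_def S T).1 h).re_inner_nonneg_left x
  rw [sub_apply, inner_sub_left, map_sub] at this
  exact sub_nonneg.1 this

lemma ContinuousLinearMap.norm_apply_sq_eq_reApplyInnerSelf (S : H →L[ℂ] H) (x : H) :
    ‖S x‖ ^ 2 = (star S * S).reApplyInnerSelf x := by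
  rw [← inner_self_eq_norm_sq (𝕜 := ℂ), reApplyInnerSelf_apply, star_eq_adjoint]
  exact congrArg RCLike.re (adjoint_inner_left S x (S x)).symm

lemma CFC.isStrictlyPositive_algebraMap_add_abs {A : Type*} [CStarAlgebra A] [PartialOrder A]
    [StarOrderedRing A] (T : A) {ε : ℝ} (hε : 0 < ε) :
    IsStrictlyPositive (algebraMap ℝ A ε + CFC.abs T) := by
  have habs : 0 ≤ CFC.abs T := CFC.abs_nonneg T
  grind

/-- With `d = (ε + |T|)⁻¹`, `d T*T d = d|T|²d ≤ 1`; hence `(T d T*)² ≤ T T*`, and the square root is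
operator monotone. -/
lemma CFC.mul_inverse_mul_star_le_abs_star {A : Type*} [CStarAlgebra A] [PartialOrder A]
    [StarOrderedRing A] (T : A) {ε : ℝ} (hε : 0 < ε) :
    T * Ring.inverse (algebraMap ℝ A ε + CFC.abs T) * star T ≤ CFC.abs (star T) := by
  set c := algebraMap ℝ A ε + CFC.abs T with hc
  have habs : 0 ≤ CFC.abs T := CFC.abs_nonneg T
  have hcpos : IsStrictlyPositive c := CFC.isStrictlyPositive_algebraMap_add_abs T hε
  set d := Ring.inverse c with hd
  have hdpos : IsStrictlyPositive d := hcpos.ringInverse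
  have hdsa : star d = d := hdpos.nonneg.isSelfAdjoint
  have hB : 0 ≤ T * d * star T := star_right_conjugate_nonneg hdpos.nonneg T
  have hconj : d * (star T * T) * d ≤ 1 := by
    have h1 : star T * T ≤ c * c := by
      rw [← CFC.abs_mul_abs, hc, ← sub_nonneg]
      have : (algebraMap ℝ A ε + CFC.abs T) * (algebraMap ℝ A ε + CFC.abs T) -
          CFC.abs T * CFC.abs T = (ε * ε) • (1 : A) + (2 * ε) • CFC.abs T := by
        simp only [Algebra.algebraMap_eq_smul_one, mul_add, add_mul, smul_mul_assoc,
          mul_smul_comm, one_mul, mul_one]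
        module
      rw [this]
      exact add_nonneg (smul_nonneg (by positivity) zero_le_one) (smul_nonneg (by positivity) habs)
    have h2 := star_left_conjugate_le_conjugate h1 d
    rw [hdsa] at h2
    refine h2.trans (le_of_eq ?_)
    rw [← mul_assoc, Ring.inverse_mul_cancel _ hcpos.isUnit, one_mul,
      Ring.mul_inverse_cancel _ hcpos.isUnit]
  have hsq : (T * d * star T) * (T * d * star T) ≤ star (star T) * star T := by
    have := star_right_conjugate_le_conjugate hconj T
    rw [star_star]
    simpa only [mul_assoc, one_mul, mul_one] using this
  have := CFC.sqrt_le_sqrt _ _ hsq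
  rwa [CFC.sqrt_mul_self _ hB] at this

/-- The shift by `ε` makes `c = ε + |T|` invertible, which replaces the polar decomposition: with `s
= c^(1/2)` and `r = c^(-1/2)`, `⟨Tx,x⟩ = ⟨sx,(Tr)*x⟩`, and Cauchy-Schwarz and AM-GM finish. -/
lemma norm_inner_le_of_pos (T : H →L[ℂ] H) {ε : ℝ} (hε : 0 < ε) (x : H) :
    2 * ‖inner ℂ (T x) x‖ ≤ ε * ‖x‖ ^ 2 + (CFC.abs T).reApplyInnerSelf x +
      (CFC.abs (star T)).reApplyInnerSelf x := by
  set c := algebraMap ℝ (H →L[ℂ] H) ε + CFC.abs T with hc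
  have hcpos : IsStrictlyPositive c := CFC.isStrictlyPositive_algebraMap_add_abs T hε
  have hdpos : IsStrictlyPositive (Ring.inverse c) := hcpos.ringInverse
  obtain ⟨s, hssa, hss, r, hrsa, hrr, hrs⟩ : ∃ s : H →L[ℂ] H, star s = s ∧ s * s = c ∧
      ∃ r : H →L[ℂ] H, star r = r ∧ r * r = Ring.inverse c ∧ r * s = 1 := by
    refine ⟨CFC.sqrt c, (CFC.sqrt_nonneg c).isSelfAdjoint, CFC.sqrt_mul_sqrt_self c hcpos.nonneg,
      CFC.sqrt (Ring.inverse c), (CFC.sqrt_nonneg _).isSelfAdjoint,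
      CFC.sqrt_mul_sqrt_self _ hdpos.nonneg, ?_⟩
    rw [CFC.sqrt_ringInverse]
    exact Ring.inverse_mul_cancel _ (CFC.isUnit_sqrt_iff_isStrictlyPositive.2 hcpos)
  have h1 : inner ℂ (T x) x = inner ℂ (s x) (star (T * r) x) := by
    rw [star_eq_adjoint, adjoint_inner_right]
    congr 1
    change _ = (T * r * s) x
    rw [mul_assoc, hrs, mul_one]
  have h2 : ‖s x‖ ^ 2 = ε * ‖x‖ ^ 2 + (CFC.abs T).reApplyInnerSelf x := by
    rw [norm_apply_sq_eq_reApplyInnerSelf, hssa, hss, hc]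
    simp only [reApplyInnerSelf_apply, add_apply, inner_add_left, map_add]
    congr 1
    rw [Algebra.algebraMap_eq_smul_one, smul_apply, one_apply_eq_self, inner_smul_left_eq_smul,
      RCLike.smul_re, inner_self_eq_norm_sq]
  have h3 : ‖star (T * r) x‖ ^ 2 ≤ (CFC.abs (star T)).reApplyInnerSelf x := by
    have h := reApplyInnerSelf_mono (CFC.mul_inverse_mul_star_le_abs_star T hε) x
    rw [← hc, ← hrr] at h
    rw [norm_apply_sq_eq_reApplyInnerSelf, star_star, star_mul, hrsa]
    simpa only [mul_assoc] using h
  have h4 : ‖inner ℂ (T x) x‖ ≤ ‖s x‖ * ‖star (T * r) x‖ := h1 ▸ norm_inner_le_norm _ _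
  nlinarith [sq_nonneg (‖s x‖ - ‖star (T * r) x‖)]

/-- The mixed Schwarz inequality, in its arithmetic mean form. -/
lemma norm_inner_le_reApplyInnerSelf_abs (T : H →L[ℂ] H) (x : H) :
    ‖inner ℂ (T x) x‖ ≤
      ((CFC.abs T).reApplyInnerSelf x + (CFC.abs (star T)).reApplyInnerSelf x) / 2 := by
  -- Let `ε` decrease to `0`.
  have : Filter.Tendsto (fun ε : ℝ => ε * ‖x‖ ^ 2 + (CFC.abs T).reApplyInnerSelf x +
      (CFC.abs (star T)).reApplyInnerSelf x) (nhdsWithin 0 (Ioi 0))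
      (nhds (0 * ‖x‖ ^ 2 + (CFC.abs T).reApplyInnerSelf x +
      (CFC.abs (star T)).reApplyInnerSelf x)) :=
    (Continuous.tendsto (by fun_prop) 0).mono_left nhdsWithin_le_nhds
  have h := ge_of_tendsto this (b := 2 * ‖inner ℂ (T x) x‖)
    (by filter_upwards [self_mem_nhdsWithin] with ε hε using norm_inner_le_of_pos T hε x)
  linarith

end MixedSchwarz

/-! ### Quadratic forms and the radius inequalities -/

namespace OperatorRadius

open ContinuousLinearMap

variable {H : Type*} [NormedAddCommGroup H] [InnerProductSpace ℂ H]

lemma reApplyInnerSelf_add_smul (S R : H →L[ℂ] H) (c d : ℝ) (x : H) :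
    (c • S + d • R).reApplyInnerSelf x = c * S.reApplyInnerSelf x + d * R.reApplyInnerSelf x := by
  simp only [reApplyInnerSelf_apply, add_apply, smul_apply, inner_add_left,
    inner_smul_left_eq_smul, map_add, RCLike.smul_re]

lemma reApplyInnerSelf_sum {ι : Type*} (s : Finset ι) (S : ι → H →L[ℂ] H) (x : H) :
    (∑ j ∈ s, S j).reApplyInnerSelf x = ∑ j ∈ s, (S j).reApplyInnerSelf x := by
  simp only [reApplyInnerSelf_apply, sum_apply, sum_inner, map_sum]

lemma reApplyInnerSelf_le_norm (S : H →L[ℂ] H) {x : H} (hx : ‖x‖ = 1) :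
    S.reApplyInnerSelf x ≤ ‖S‖ := by
  have h := (RCLike.re_le_norm _).trans (norm_inner_le_norm (𝕜 := ℂ) (S x) x)
  have := S.le_opNorm x
  rw [hx, mul_one] at this h
  exact h.trans this

lemma fRadius_rpow {p : ℝ} (hp : p ≠ 0) {n : ℕ} (T : Fin n → (H →L[ℂ] H)) :
    fRadius (fun t : ℝ≥0 => t ^ p) T = euclideanRadius p T := by
  unfold fRadius euclideanRadius
  congr 1
  ext x
  have hinv : ∀ y : ℝ≥0, Function.invFun (fun t : ℝ≥0 => t ^ p) y = y ^ (1 / p) := fun y => by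
    have h := Function.leftInverse_invFun (NNReal.rpow_left_injective hp) (y ^ (1 / p))
    rwa [one_div, NNReal.rpow_inv_rpow hp, ← one_div] at h
  rw [hinv]
  simp

section Segment
variable {A : Type*} [CStarAlgebra A] [PartialOrder A] [StarOrderedRing A] {ι : Type*} [Fintype ι]

lemma segment_nonneg {a b : A} (ha : 0 ≤ a) (hb : 0 ≤ b) {t : ℝ} (ht : t ∈ Icc (0 : ℝ) 1) :
    0 ≤ t • a + (1 - t) • b :=
  add_nonneg (smul_nonneg ht.1 ha) (smul_nonneg (sub_nonneg.2 ht.2) hb)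

lemma convexOn_segment_rpow {a b : A} (ha : 0 ≤ a) (hb : 0 ≤ b) {p : ℝ} (hp₁ : 1 ≤ p)
    (hp₂ : p ≤ 2) : ConvexOn ℝ (Icc (0 : ℝ) 1) (fun t => (t • a + (1 - t) • b) ^ p) := by
  refine ⟨convex_Icc 0 1, fun s hs t ht u v hu hv huv => ?_⟩
  have h := (CFC.convexOn_rpow hp₁ hp₂).2 (segment_nonneg ha hb hs) (segment_nonneg ha hb ht)
    hu hv huv
  convert h using 2
  obtain rfl : v = 1 - u := by linarith
  simp only [smul_eq_mul]
  module

lemma convexOn_sum_segment_rpow {a b : ι → A} (ha : ∀ j, 0 ≤ a j) (hb : ∀ j, 0 ≤ b j) {p : ℝ}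
    (hp₁ : 1 ≤ p) (hp₂ : p ≤ 2) :
    ConvexOn ℝ (Icc (0 : ℝ) 1) (fun t => ∑ j, (t • a j + (1 - t) • b j) ^ p) := by
  refine ⟨convex_Icc 0 1, fun s hs t ht u v hu hv huv => ?_⟩
  simp only [Finset.smul_sum, ← Finset.sum_add_distrib]
  exact Finset.sum_le_sum fun j _ =>
    (convexOn_segment_rpow (ha j) (hb j) hp₁ hp₂).2 hs ht hu hv huv

lemma continuousOn_sum_segment_rpow {a b : ι → A} (ha : ∀ j, 0 ≤ a j) (hb : ∀ j, 0 ≤ b j) {p : ℝ}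
    (hp : 0 < p) :
    ContinuousOn (fun t : ℝ => ∑ j, (t • a j + (1 - t) • b j) ^ p) (Icc 0 1) :=
  continuousOn_finsetSum _ fun j _ => (CFC.continuousOn_rpow_of_pos hp).comp (by fun_prop)
    fun _ ht => segment_nonneg (ha j) (hb j) ht

/-- The Hermite-Hadamard inequality for sums of operator powers along a segment, with the left
half applied on the two pieces `[0, 1 - lam]` and `[1 - lam, 1]`. -/
lemma hermiteHadamard_sum_segment_rpow {a b : ι → A} (ha : ∀ j, 0 ≤ a j) (hb : ∀ j, 0 ≤ b j)
    {p : ℝ} (hp₁ : 1 ≤ p) (hp₂ : p ≤ 2) {lam : ℝ} (hlam₀ : 0 ≤ lam) (hlam₁ : lam ≤ 1) :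
    IntervalIntegrable (fun t : ℝ => ∑ j, (t • a j + (1 - t) • b j) ^ p) MeasureTheory.volume 0 1 ∧
    ∑ j, ((1 - lam) • (((1 - lam) / 2) • a j + ((1 + lam) / 2) • b j) ^ p +
      lam • (((2 - lam) / 2) • a j + (lam / 2) • b j) ^ p) ≤
      ∫ t in (0 : ℝ)..1, ∑ j, (t • a j + (1 - t) • b j) ^ p ∧
    ∫ t in (0 : ℝ)..1, ∑ j, (t • a j + (1 - t) • b j) ^ p ≤
      (1 / 2 : ℝ) • ∑ j, (a j ^ p + b j ^ p) := by
  have hconv := convexOn_sum_segment_rpow ha hb hp₁ hp₂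
  have hcont := continuousOn_sum_segment_rpow ha hb (zero_lt_one.trans_le hp₁)
  have hint : ∀ c d : ℝ, 0 ≤ c → c ≤ d → d ≤ 1 → IntervalIntegrable
      (fun t : ℝ => ∑ j, (t • a j + (1 - t) • b j) ^ p) MeasureTheory.volume c d :=
    fun c d hc hcd hd => (hcont.mono (Icc_subset_Icc hc hd)).intervalIntegrable_of_Icc hcd
  refine ⟨hint 0 1 le_rfl zero_le_one le_rfl, ?_, ?_⟩
  -- Split at `1 - lam`; the lengths of the two pieces become the weights.
  · have h0 : 0 ≤ 1 - lam := sub_nonneg.2 hlam₁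
    have h1 : 1 - lam ≤ 1 := sub_le_self _ hlam₀
    rw [← intervalIntegral.integral_add_adjacent_intervals (hint 0 _ le_rfl h0 h1)
      (hint _ 1 h0 h1 le_rfl)]
    refine le_trans (le_of_eq ?_) (add_le_add
      ((hconv.subset (Icc_subset_Icc_right h1) (convex_Icc _ _)).smul_midpoint_le_integral h0
        (hint 0 _ le_rfl h0 h1))
      ((hconv.subset (Icc_subset_Icc_left h0) (convex_Icc _ _)).smul_midpoint_le_integral h1
        (hint _ 1 h0 h1 le_rfl)))
    rw [Finset.sum_add_distrib, ← Finset.smul_sum, ← Finset.smul_sum]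
    have e₁ : (0 + (1 - lam)) / 2 = (1 - lam) / 2 := by ring
    have e₂ : 1 - (1 - lam) / 2 = (1 + lam) / 2 := by ring
    have e₃ : (1 - lam + 1) / 2 = (2 - lam) / 2 := by ring
    have e₄ : 1 - (2 - lam) / 2 = lam / 2 := by ring
    simp only [e₁, e₂, e₃, e₄, sub_zero, sub_sub_cancel]
  · refine (hconv.integral_le_smul_add zero_le_one (hint 0 1 le_rfl zero_le_one le_rfl)).trans
      (le_of_eq ?_)
    simp [Finset.sum_add_distrib, add_comm]

end Segment

variable [CompleteSpace H]

/-- The Hölder-McCarthy inequality. -/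
lemma reApplyInnerSelf_rpow_le {S : H →L[ℂ] H} (hS : 0 ≤ S) {p : ℝ} (hp : 1 ≤ p) {x : H}
    (hx : ‖x‖ = 1) : S.reApplyInnerSelf x ^ p ≤ (S ^ p).reApplyInnerSelf x := by
  have h0 : 0 ≤ S.reApplyInnerSelf x := ((nonneg_iff_isPositive S).1 hS).re_inner_nonneg_left x
  -- The tangent line is taken at `s = ⟨Sx,x⟩`, which must be positive; its quadratic form at the
  -- unit vector `x` is then `s^p`.
  obtain hs | hs := h0.eq_or_lt
  · rw [← hs, Real.zero_rpow (by linarith)]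
    exact ((nonneg_iff_isPositive _).1 CFC.rpow_nonneg).re_inner_nonneg_left x
  refine le_trans (le_of_eq ?_) (reApplyInnerSelf_mono (CFC.tangent_le_rpow hp hs hS) x)
  generalize hs' : S.reApplyInnerSelf x = s at hs
  rw [reApplyInnerSelf_apply] at hs' ⊢
  simp only [add_apply, smul_apply, one_apply_eq_self, inner_add_left, inner_smul_left_eq_smul,
    map_add, RCLike.smul_re, hs', inner_self_eq_norm_sq, hx]
  rw [Real.rpow_sub_one hs.ne']
  field_simp
  ring

lemma norm_inner_rpow_le (T : H →L[ℂ] H) {p lam : ℝ} (hp : 1 ≤ p) (hlam₀ : 0 ≤ lam)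
    (hlam₁ : lam ≤ 1) {x : H} (hx : ‖x‖ = 1) :
    ‖inner ℂ (T x) x‖ ^ p ≤ ((1 - lam) • (((1 - lam) / 2) • CFC.abs T +
        ((1 + lam) / 2) • CFC.abs (star T)) ^ p +
      lam • (((2 - lam) / 2) • CFC.abs T + (lam / 2) • CFC.abs (star T)) ^ p).reApplyInnerSelf
      x := by
  have ha := CFC.abs_nonneg T
  have hb := CFC.abs_nonneg (star T)
  have h0 : 0 ≤ 1 - lam := sub_nonneg.2 hlam₁
  set M := ((1 - lam) / 2) • CFC.abs T + ((1 + lam) / 2) • CFC.abs (star T) with hM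
  set N := ((2 - lam) / 2) • CFC.abs T + (lam / 2) • CFC.abs (star T) with hN
  have hM0 : 0 ≤ M := add_nonneg (smul_nonneg (by linarith) ha) (smul_nonneg (by linarith) hb)
  have hN0 : 0 ≤ N := add_nonneg (smul_nonneg (by linarith) ha) (smul_nonneg (by linarith) hb)
  have hle : ‖inner ℂ (T x) x‖ ≤
      (1 - lam) * M.reApplyInnerSelf x + lam * N.reApplyInnerSelf x := by
    refine (norm_inner_le_reApplyInnerSelf_abs T x).trans (le_of_eq ?_)
    rw [hM, hN, reApplyInnerSelf_add_smul, reApplyInnerSelf_add_smul]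
    ring
  rw [reApplyInnerSelf_add_smul]
  calc ‖inner ℂ (T x) x‖ ^ p
      ≤ ((1 - lam) * M.reApplyInnerSelf x + lam * N.reApplyInnerSelf x) ^ p := by gcongr
    _ ≤ (1 - lam) * M.reApplyInnerSelf x ^ p + lam * N.reApplyInnerSelf x ^ p :=
        (convexOn_rpow hp).2 (((nonneg_iff_isPositive M).1 hM0).re_inner_nonneg_left x)
          (((nonneg_iff_isPositive N).1 hN0).re_inner_nonneg_left x) h0 hlam₀ (by ring)
    _ ≤ _ := by
        gcongr
        · exact reApplyInnerSelf_rpow_le hM0 hp hx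
        · exact reApplyInnerSelf_rpow_le hN0 hp hx

lemma sum_norm_inner_rpow_le {n : ℕ} (T : Fin n → H →L[ℂ] H) {p lam : ℝ} (hp : 1 ≤ p)
    (hlam₀ : 0 ≤ lam) (hlam₁ : lam ≤ 1) {x : H} (hx : ‖x‖ = 1) :
    ∑ j, ‖inner ℂ (T j x) x‖ ^ p ≤ ‖∑ j, ((1 - lam) • (((1 - lam) / 2) • CFC.abs (T j) +
        ((1 + lam) / 2) • CFC.abs (star (T j))) ^ p +
      lam • (((2 - lam) / 2) • CFC.abs (T j) + (lam / 2) • CFC.abs (star (T j))) ^ p)‖ := by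
  refine le_trans ?_ (reApplyInnerSelf_le_norm _ hx)
  rw [reApplyInnerSelf_sum]
  exact Finset.sum_le_sum fun j _ => norm_inner_rpow_le (T j) hp hlam₀ hlam₁ hx

lemma norm_sum_le_norm_integral_le {n : ℕ} (T : Fin n → H →L[ℂ] H) {p lam : ℝ} (hp₁ : 1 ≤ p) (hp₂ : p ≤ 2)
    (hlam₀ : 0 ≤ lam) (hlam₁ : lam ≤ 1) :
    ‖∑ j, ((1 - lam) • (((1 - lam) / 2) • CFC.abs (T j) +
        ((1 + lam) / 2) • CFC.abs (star (T j))) ^ p +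
      lam • (((2 - lam) / 2) • CFC.abs (T j) + (lam / 2) • CFC.abs (star (T j))) ^ p)‖ ≤
      ‖∫ t in (0 : ℝ)..1, ∑ j, (t • CFC.abs (T j) + (1 - t) • CFC.abs (star (T j))) ^ p‖ ∧
    ‖∫ t in (0 : ℝ)..1, ∑ j, (t • CFC.abs (T j) + (1 - t) • CFC.abs (star (T j))) ^ p‖ ≤
      (1 / 2) * ‖∑ j, (CFC.abs (T j) ^ p + CFC.abs (star (T j)) ^ p)‖ := by
  obtain ⟨-, h₁, h₂⟩ := hermiteHadamard_sum_segment_rpow (a := fun j => CFC.abs (T j))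
    (b := fun j => CFC.abs (star (T j))) (fun _ => CFC.abs_nonneg _) (fun _ => CFC.abs_nonneg _)
    hp₁ hp₂ hlam₀ hlam₁
  have h0 : 0 ≤ ∑ j, ((1 - lam) • (((1 - lam) / 2) • CFC.abs (T j) +
        ((1 + lam) / 2) • CFC.abs (star (T j))) ^ p +
      lam • (((2 - lam) / 2) • CFC.abs (T j) + (lam / 2) • CFC.abs (star (T j))) ^ p) :=
    Finset.sum_nonneg fun j _ => add_nonneg (smul_nonneg (sub_nonneg.2 hlam₁) CFC.rpow_nonneg)
      (smul_nonneg hlam₀ CFC.rpow_nonneg)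
  refine ⟨CStarAlgebra.norm_le_norm_of_nonneg_of_le h0 h₁, ?_⟩
  refine (CStarAlgebra.norm_le_norm_of_nonneg_of_le (h0.trans h₁) h₂).trans (le_of_eq ?_)
  rw [norm_smul]
  norm_num

lemma rpow_two_eq_sq {A : Type*} [CStarAlgebra A] [PartialOrder A] [StarOrderedRing A] {a : A}
    (ha : 0 ≤ a) : a ^ (2 : ℝ) = a ^ 2 := by
  simpa using CFC.rpow_natCast a 2 ha

end OperatorRadius

theorem mainTheorem11 {H : Type*} [NormedAddCommGroup H] [InnerProductSpace ℂ H] [CompleteSpace H]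
    (lam : ℝ) (hlam₀ : 0 ≤ lam) (hlam₁ : lam ≤ 1) :
    (∀ (p : ℝ), 1 ≤ p → p ≤ 2 → ∀ (n : ℕ) (T : Fin n → (H →L[ℂ] H)),
      OperatorRadius.fRadius (fun t : ℝ≥0 => t ^ p) T = OperatorRadius.euclideanRadius p T ∧
      OperatorRadius.euclideanRadius p T ≤
        ‖∑ j, ((1 - lam) • (((1 - lam) / 2) • CFC.abs (T j) +
              ((1 + lam) / 2) • CFC.abs (star (T j))) ^ p +
            lam • (((2 - lam) / 2) • CFC.abs (T j) +
              (lam / 2) • CFC.abs (star (T j))) ^ p)‖ ^ (1 / p) ∧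
      IntervalIntegrable (fun t : ℝ => ∑ j, (t • CFC.abs (T j) +
          (1 - t) • CFC.abs (star (T j))) ^ p) MeasureTheory.volume 0 1 ∧
      ‖∑ j, ((1 - lam) • (((1 - lam) / 2) • CFC.abs (T j) +
              ((1 + lam) / 2) • CFC.abs (star (T j))) ^ p +
            lam • (((2 - lam) / 2) • CFC.abs (T j) +
              (lam / 2) • CFC.abs (star (T j))) ^ p)‖ ^ (1 / p) ≤
        ‖∫ t in (0 : ℝ)..1, ∑ j, (t • CFC.abs (T j) +
          (1 - t) • CFC.abs (star (T j))) ^ p‖ ^ (1 / p) ∧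
      ‖∫ t in (0 : ℝ)..1, ∑ j, (t • CFC.abs (T j) +
          (1 - t) • CFC.abs (star (T j))) ^ p‖ ^ (1 / p) ≤
        ((1 / 2) * ‖∑ j, (CFC.abs (T j) ^ p +
          CFC.abs (star (T j)) ^ p)‖) ^ (1 / p)) ∧
    (∀ T : H →L[ℂ] H,
      OperatorRadius.numericalRadius T ^ 2 ≤
        ‖(1 - lam) • (((1 - lam) / 2) • CFC.abs T +
              ((1 + lam) / 2) • CFC.abs (star T)) ^ 2 +
            lam • (((2 - lam) / 2) • CFC.abs T +
              (lam / 2) • CFC.abs (star T)) ^ 2‖ ∧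
      ‖(1 - lam) • (((1 - lam) / 2) • CFC.abs T +
              ((1 + lam) / 2) • CFC.abs (star T)) ^ 2 +
            lam • (((2 - lam) / 2) • CFC.abs T +
              (lam / 2) • CFC.abs (star T)) ^ 2‖ ≤
        ‖∫ t in (0 : ℝ)..1, (t • CFC.abs T +
          (1 - t) • CFC.abs (star T)) ^ 2‖ ∧
      ‖∫ t in (0 : ℝ)..1, (t • CFC.abs T +
          (1 - t) • CFC.abs (star T)) ^ 2‖ ≤
        (1 / 2) * ‖CFC.abs T ^ 2 + CFC.abs (star T) ^ 2‖) := by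
  refine ⟨fun p hp₁ hp₂ n T => ?_, fun T => ?_⟩
  · have hp : 0 < p := zero_lt_one.trans_le hp₁
    have hp' : 0 ≤ 1 / p := by positivity
    obtain ⟨h₁, h₂⟩ := OperatorRadius.norm_sum_le_norm_integral_le T hp₁ hp₂ hlam₀ hlam₁
    refine ⟨OperatorRadius.fRadius_rpow hp.ne' T, ?_, ?_, Real.rpow_le_rpow (norm_nonneg _) h₁ hp',
      Real.rpow_le_rpow (norm_nonneg _) h₂ hp'⟩
    -- The nonnegativity goal covers `H = 0`, where the unit sphere is empty and the supremum is
    -- `0`.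
    · refine Real.iSup_le (fun x => ?_) (by positivity)
      exact Real.rpow_le_rpow (Finset.sum_nonneg fun _ _ => by positivity)
        (OperatorRadius.sum_norm_inner_rpow_le T hp₁ hlam₀ hlam₁ x.2) hp'
    · exact (OperatorRadius.hermiteHadamard_sum_segment_rpow (a := fun j => CFC.abs (T j))
        (b := fun j => CFC.abs (star (T j))) (fun _ => CFC.abs_nonneg _)
        (fun _ => CFC.abs_nonneg _) hp₁ hp₂ hlam₀ hlam₁).1
  · have ha := CFC.abs_nonneg T
    have hb := CFC.abs_nonneg (star T)
    have hω : ∀ x : {x : H // ‖x‖ = 1}, _ := fun x =>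
      OperatorRadius.sum_norm_inner_rpow_le (fun _ : Fin 1 => T) one_le_two hlam₀ hlam₁ x.2
    obtain ⟨h₁, h₂⟩ := OperatorRadius.norm_sum_le_norm_integral_le (fun _ : Fin 1 => T) one_le_two le_rfl hlam₀ hlam₁
    have hM : 0 ≤ ((1 - lam) / 2) • CFC.abs T + ((1 + lam) / 2) • CFC.abs (star T) :=
      add_nonneg (smul_nonneg (by linarith) ha) (smul_nonneg (by linarith) hb)
    have hN : 0 ≤ ((2 - lam) / 2) • CFC.abs T + (lam / 2) • CFC.abs (star T) :=
      add_nonneg (smul_nonneg (by linarith) ha) (smul_nonneg (by linarith) hb)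
    -- Real and natural squares are identified only on positive elements, hence the restriction to
    -- `t ∈ [0,1]`.
    have hI : ∫ t in (0 : ℝ)..1, (t • CFC.abs T + (1 - t) • CFC.abs (star T)) ^ (2 : ℝ) =
        ∫ t in (0 : ℝ)..1, (t • CFC.abs T + (1 - t) • CFC.abs (star T)) ^ 2 := by
      refine intervalIntegral.integral_congr fun t ht => OperatorRadius.rpow_two_eq_sq (OperatorRadius.segment_nonneg ha hb ?_)
      rwa [uIcc_of_le zero_le_one] at ht
    simp only [Fin.sum_univ_one, OperatorRadius.rpow_two_eq_sq hM, OperatorRadius.rpow_two_eq_sq hN, OperatorRadius.rpow_two_eq_sq ha,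
      OperatorRadius.rpow_two_eq_sq hb, hI, Real.rpow_two] at hω h₁ h₂
    refine ⟨?_, h₁, h₂⟩
    -- Passing to square roots avoids commuting the square with the supremum.
    refine (Real.le_sqrt (Real.iSup_nonneg fun _ => norm_nonneg _) (norm_nonneg _)).1 ?_
    exact Real.iSup_le (fun x => Real.le_sqrt_of_sq_le (hω x)) (Real.sqrt_nonneg _)
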